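/- Let $(R,\mathfrak m)$ be a Noetherian local ring of prime characteristic $p>0$ and of Krull dimension $d$, and let $L\subseteq M\subseteq N$ be $R$-modules such that $M/L$ is finitely generated. Notation. For $e\ge 0$ and $q=p^e$, let $F^e(N)=N\otimes_R{}^eR$ be the base change of $N$ along the $e$-fold Frobenius $R\to R$, $r\mapsto r^{q}$; for $z\in N$ let $z^q_N=z\otimes 1\in F^e(N)$; and for a submodule $K\subseteq N$ let $K^{[q]}_N$ be the image of $F^e(K)\to F^e(N)$. The tight closure $L^*_N$ is the set of all $z\in N$ for which there is a $c\in R$, lying in no minimal prime of $R$, with $c\,z^q_N\in L^{[q]}_N$ for all $q=p^e\gg 0$. For an $R$-module $A$, let $\Gamma_{\mathfrak m}(A)=\{a\in A:\mathfrak m^n a=0\text{ for some }n\}$, and let $\lambda$ denote length over $R$. The relative multiplicity of $L$ against $M$ in $N$ is $$\lim_{q\to\infty}\frac{\lambda\bigl(\Gamma_{\mathfrak m}(M^{[q]}_N/L^{[q]}_N)\bigr)}{q^d};$$ it is said to exist if the corresponding $\limsup$ and $\liminf$ in $[0,\infty]$ are equal. Let $R[x;f]$ be the skew polynomial ring of the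 Frobenius endomorphism $f(r)=r^p$, i.e. $\bigoplus_{n\ge 0}Rx^n$ with $(rx^n)(sx^m)=r\,s^{p^n}x^{n+m}$. The graded $R$-module $\mathcal M=\bigoplus_{e\ge0}(M^{[p^e]}_N/L^{[p^e]}_N)X^e$ is a left $R[x;f]$-module via $x\cdot\overline{u}X^e=\overline{u^p}X^{e+1}$, where $u\mapsto u^p$ is the map $F^e(N)\to F^{e+1}(N)$, $n\otimes r\mapsto n\otimes r^p$, and $$\mathcal H=\bigoplus_{e\ge0}\Gamma_{\mathfrak m}\bigl(M^{[p^e]}_N/L^{[p^e]}_N\bigr)X^e$$ is an $R[x;f]$-submodule of $\mathcal M$. Theorem. Suppose that $\mathcal H$ is finitely generated as a left $R[x;f]$-module. If $M\subseteq L^*_N$, then the relative multiplicity of $L$ against $M$ in $N$ exists and equals $0$. More precisely, there is moreover a real constant $C\geq 0$ such that $\lambda\bigl(\Gamma_{\mathfrak m}(M^{[q]}_N/L^{[q]}_N)\bigr)\le C\,q^{d-1}$ for all $q=p^e$, $e\ge 0$. -/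

import Mathlib

open Filter DirectSum TensorProduct
open scoped ENNReal NNReal

noncomputable section

/-! ### The Frobenius functors and bracket powers -/

/-- The bimodule `ᵉR`: the ring `R`, on which `R` acts on one side (through the `Algebra` structure
below) by `r · z = r ^ (p ^ e) * z`, and on the other side by ordinary multiplication. -/
def FrobeniusTwist (R : Type*) (_p _e : ℕ) : Type _ := R

namespace FrobeniusTwist

variable (R : Type*) [CommRing R] (p : ℕ) [Fact p.Prime] [CharP R p] (e : ℕ)

instance : CommRing (FrobeniusTwist R p e) := inferInstanceAs (CommRing R)

/-- The identity map of `R`, as a ring isomorphism `R ≃ ᵉR`. -/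
def of : R ≃+* FrobeniusTwist R p e := RingEquiv.refl R

instance : Algebra R (FrobeniusTwist R p e) :=
  ((of R p e).toRingHom.comp (iterateFrobenius R p e)).toAlgebra

theorem smul_of (a r : R) : a • of R p e r = of R p e (a ^ p ^ e * r) := rfl

/-- The `p`-th power map `ᵉR → ᵉ⁺¹R`. -/
def powMap : FrobeniusTwist R p e →ₗ[R] FrobeniusTwist R p (e + 1) where
  toFun z := of R p (e + 1) (frobenius R p ((of R p e).symm z))
  map_add' x y := by simp
  map_smul' a z := by
    obtain ⟨r, rfl⟩ := (of R p e).surjective z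
    rw [smul_of, RingHom.id_apply, RingEquiv.symm_apply_apply, RingEquiv.symm_apply_apply, smul_of]
    simp only [frobenius_def, mul_pow, ← pow_mul, pow_succ]

end FrobeniusTwist

/-- The Frobenius functor `Fᵉ(N) = N ⊗_R ᵉR`, with the `R`-module structure coming from ordinary
multiplication on `ᵉR`, so that `a • (r ⊗ n) = (a * r) ⊗ n` and
`r ⊗ (a • n) = (a ^ (p ^ e) * r) ⊗ n`. -/
def FrobeniusPullback (R : Type*) [CommRing R] (p : ℕ) [Fact p.Prime] [CharP R p] (e : ℕ)
    (N : Type*) [AddCommGroup N] [Module R N] : Type _ :=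
  FrobeniusTwist R p e ⊗[R] N

namespace FrobeniusPullback

variable {R : Type*} [CommRing R] (p : ℕ) [Fact p.Prime] [CharP R p] (e : ℕ)
variable {N : Type*} [AddCommGroup N] [Module R N] {N' : Type*} [AddCommGroup N'] [Module R N']

instance : AddCommGroup (FrobeniusPullback R p e N) :=
  inferInstanceAs (AddCommGroup (FrobeniusTwist R p e ⊗[R] N))

instance : Module (FrobeniusTwist R p e) (FrobeniusPullback R p e N) :=
  inferInstanceAs (Module (FrobeniusTwist R p e) (FrobeniusTwist R p e ⊗[R] N))

instance : Module R (FrobeniusPullback R p e N) :=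
  Module.compHom _ (FrobeniusTwist.of R p e).toRingHom

/-- The pure tensor `r ⊗ n` in `Fᵉ(N)`. -/
def tmul (r : R) (n : N) : FrobeniusPullback R p e N :=
  (FrobeniusTwist.of R p e r ⊗ₜ[R] n : FrobeniusTwist R p e ⊗[R] N)

variable {p e}

theorem induction_on {P : FrobeniusPullback R p e N → Prop} (z : FrobeniusPullback R p e N)
    (h0 : P 0) (ht : ∀ r n, P (tmul p e r n)) (ha : ∀ x y, P x → P y → P (x + y)) : P z :=
  TensorProduct.induction_on (motive := P) z h0 ht ha

theorem smul_tmul (a r : R) (n : N) : a • tmul p e r n = tmul p e (a * r) n := rfl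

theorem tmul_smul (a r : R) (n : N) : tmul p e r (a • n) = tmul p e (a ^ p ^ e * r) n := by
  unfold tmul
  rw [← FrobeniusTwist.smul_of, TensorProduct.smul_tmul]

theorem tmul_add (r : R) (m n : N) : tmul p e r (m + n) = tmul p e r m + tmul p e r n :=
  TensorProduct.tmul_add _ _ _

theorem tmul_zero (r : R) : tmul p e r (0 : N) = 0 := TensorProduct.tmul_zero _ _

variable (p e)

/-- `Fᵉ` on `R`-linear maps. -/
def map (f : N →ₗ[R] N') : FrobeniusPullback R p e N →ₗ[R] FrobeniusPullback R p e N' where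
  toFun := f.baseChange (FrobeniusTwist R p e)
  map_add' x y := (f.baseChange (FrobeniusTwist R p e)).map_add x y
  map_smul' a x := (f.baseChange (FrobeniusTwist R p e)).map_smul (FrobeniusTwist.of R p e a) x

theorem map_tmul (f : N →ₗ[R] N') (r : R) (n : N) :
    map p e f (tmul p e r n) = tmul p e r (f n) := rfl

/-- The element `z ^ q = z ⊗ 1` of `Fᵉ(N)`, where `q = p ^ e`. -/
def pow (z : N) : FrobeniusPullback R p e N := tmul p e 1 z

/-- The additive map underlying `frob` below. -/
def frobAddHom : FrobeniusPullback R p e N →+ FrobeniusPullback R p (e + 1) N :=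
  ((FrobeniusTwist.powMap R p e).rTensor N).toAddMonoidHom

/-- The map `Fᵉ(N) → Fᵉ⁺¹(N) = F(Fᵉ(N))`, `u ↦ u ^ p`, given by `r ⊗ n ↦ r ^ p ⊗ n`; it is
semilinear for the Frobenius endomorphism. -/
def frob : FrobeniusPullback R p e N →ₛₗ[frobenius R p] FrobeniusPullback R p (e + 1) N where
  toFun := frobAddHom p e
  map_add' := map_add (frobAddHom p e)
  map_smul' a x := by
    induction x using induction_on with
    | h0 => rw [smul_zero, map_zero, smul_zero]
    | ht r n =>
      change tmul p (e + 1) (frobenius R p (a * r)) n =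
        tmul p (e + 1) (frobenius R p a * frobenius R p r) n
      rw [map_mul]
    | ha x y hx hy => rw [smul_add, map_add, map_add, smul_add, hx, hy]

theorem frob_tmul (r : R) (n : N) :
    frob p e (tmul p e r n) = tmul p (e + 1) (r ^ p) n := rfl

theorem frob_map (f : N →ₗ[R] N') (z : FrobeniusPullback R p e N) :
    frob p e (map p e f z) = map p (e + 1) f (frob p e z) := by
  induction z using induction_on with
  | h0 => simp
  | ht r n => rw [map_tmul, frob_tmul, frob_tmul, map_tmul]
  | ha x y hx hy => rw [map_add, map_add, hx, hy, map_add, map_add]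

end FrobeniusPullback

section Main

variable {R : Type*} [CommRing R] (p : ℕ) [Fact p.Prime] [CharP R p]
variable {N : Type*} [AddCommGroup N] [Module R N]

/-- The bracket power `L^{[q]}_N`, `q = p ^ e`: the image of `Fᵉ(L) → Fᵉ(N)`. -/
def bracketPower (e : ℕ) (L : Submodule R N) : Submodule R (FrobeniusPullback R p e N) :=
  LinearMap.range (FrobeniusPullback.map p e L.subtype)

theorem frob_mem_bracketPower (e : ℕ) (L : Submodule R N) (z : FrobeniusPullback R p e N)
    (hz : z ∈ bracketPower p e L) : FrobeniusPullback.frob p e z ∈ bracketPower p (e + 1) L := by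
  obtain ⟨w, rfl⟩ := hz
  exact ⟨FrobeniusPullback.frob p e w, (FrobeniusPullback.frob_map p e L.subtype w).symm⟩

/-! ### Tight closure -/

/-- `R°`: the elements that lie in no minimal prime of `R`. -/
def ringCirc (R : Type*) [CommRing R] : Submonoid R where
  carrier := {c | ∀ P ∈ minimalPrimes R, c ∉ P}
  one_mem' P hP h := hP.1.1.ne_top ((Ideal.eq_top_iff_one P).2 h)
  mul_mem' ha hb P hP h := (hP.1.1.mem_or_mem h).elim (ha P hP) (hb P hP)

/-- The tight closure `L^*_N` of a submodule `L` of `N`. -/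
def tightClosure (L : Submodule R N) : Submodule R N where
  carrier := {z | ∃ c ∈ ringCirc R, ∀ᶠ e : ℕ in atTop,
    c • FrobeniusPullback.pow p e z ∈ bracketPower p e L}
  zero_mem' := ⟨1, one_mem _, .of_forall fun e => by
    have h : FrobeniusPullback.pow p e (0 : N) = (0 : FrobeniusPullback R p e N) :=
      FrobeniusPullback.tmul_zero (1 : R)
    rw [h, smul_zero]
    exact zero_mem _⟩
  add_mem' := by
    rintro x y ⟨c, hc, hx⟩ ⟨c', hc', hy⟩
    refine ⟨c * c', mul_mem hc hc', ?_⟩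
    filter_upwards [hx, hy] with e hx hy
    rw [FrobeniusPullback.pow, FrobeniusPullback.tmul_add, smul_add]
    refine add_mem ?_ ?_
    · rw [mul_comm, mul_smul]
      exact Submodule.smul_mem _ _ hx
    · rw [mul_smul]
      exact Submodule.smul_mem _ _ hy
  smul_mem' := by
    rintro a x ⟨c, hc, hx⟩
    refine ⟨c, hc, ?_⟩
    filter_upwards [hx] with e hx
    have : c • FrobeniusPullback.pow (R := R) p e (a • x) =
        a ^ p ^ e • c • FrobeniusPullback.pow (R := R) p e x := by
      simp only [FrobeniusPullback.pow, FrobeniusPullback.tmul_smul,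
        FrobeniusPullback.smul_tmul]
      congr 1
      ring
    rw [this]
    exact Submodule.smul_mem _ _ hx

/-! ### Torsion and relative multiplicity -/

/-- `Γ_I(A)`: the elements of `A` killed by some power of `I`. -/
def idealTorsion (I : Ideal R) (A : Type*) [AddCommGroup A] [Module R A] : Submodule R A where
  carrier := {z | ∃ n : ℕ, ∀ r ∈ I ^ n, r • z = 0}
  zero_mem' := ⟨0, fun r _ => smul_zero r⟩
  add_mem' := by
    rintro x y ⟨m, hm⟩ ⟨n, hn⟩
    refine ⟨m + n, fun r hr => ?_⟩
    rw [smul_add, hm r (Ideal.pow_le_pow_right (Nat.le_add_right m n) hr),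
      hn r (Ideal.pow_le_pow_right (Nat.le_add_left n m) hr), add_zero]
  smul_mem' := by
    rintro a x ⟨m, hm⟩
    exact ⟨m, fun r hr => by rw [smul_comm, hm r hr, smul_zero]⟩

/-- The module `M^{[q]}_N / L^{[q]}_N`, `q = p ^ e`. -/
abbrev BracketQuotient (L M : Submodule R N) (e : ℕ) : Type _ :=
  ↥(bracketPower p e M) ⧸ (bracketPower p e L).submoduleOf (bracketPower p e M)

/-- The length of `Γ_𝔪(M^{[q]}_N / L^{[q]}_N)`, `q = p ^ e`. -/
def torsionLength [IsLocalRing R] (L M : Submodule R N) (e : ℕ) : ℝ≥0∞ :=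
  ((Module.length R (idealTorsion (IsLocalRing.maximalIdeal R) (BracketQuotient p L M e)) : ℕ∞) :
    ℝ≥0∞)

/-- The Krull dimension of `R` as a natural number (it is finite for a Noetherian local ring). -/
def krullDimNat (R : Type*) [CommRing R] : ℕ := ((ringKrullDim R).unbotD 0).toNat

theorem coe_krullDimNat (R : Type*) [CommRing R] [IsLocalRing R] [IsNoetherianRing R] :
    ((krullDimNat R : ℕ) : WithBot ℕ∞) = ringKrullDim R := by
  have h1 : ringKrullDim R ≠ ⊥ := ringKrullDim_ne_bot
  have h2 : ringKrullDim R ≠ ⊤ := ringKrullDim_ne_top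
  unfold krullDimNat
  generalize ringKrullDim R = d at h1 h2
  induction d using WithBot.recBotCoe with
  | bot => exact absurd rfl h1
  | coe d =>
    induction d using ENat.recTopCoe with
    | top => exact absurd rfl h2
    | coe d => rfl

/-- The upper relative multiplicity of `L` against `M` in `N`. -/
def relMultSup [IsLocalRing R] (L M : Submodule R N) : ℝ≥0∞ :=
  limsup (fun e : ℕ => torsionLength p L M e / ((p : ℝ≥0∞) ^ e) ^ krullDimNat R) atTop

/-- The lower relative multiplicity of `L` against `M` in `N`. -/
def relMultInf [IsLocalRing R] (L M : Submodule R N) : ℝ≥0∞ :=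
  liminf (fun e : ℕ => torsionLength p L M e / ((p : ℝ≥0∞) ^ e) ^ krullDimNat R) atTop

/-- The relative multiplicity of `L` against `M` in `N` exists and equals `a`. -/
def HasRelMult [IsLocalRing R] (L M : Submodule R N) (a : ℝ≥0∞) : Prop :=
  relMultSup p L M = a ∧ relMultInf p L M = a

/-! ### The skew polynomial ring and the graded modules over it -/

/-- The action of the natural numbers on `R` by iterates of Frobenius. -/
@[reducible]
def frobeniusAction (R : Type*) [CommRing R] (p : ℕ) [Fact p.Prime] [CharP R p] :
    MulSemiringAction (Multiplicative ℕ) R where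
  smul n r := iterateFrobenius R p n.toAdd r
  one_smul r := by
    change iterateFrobenius R p 0 r = r
    simp
  mul_smul m n r := by
    change iterateFrobenius R p (m.toAdd + n.toAdd) r =
      iterateFrobenius R p m.toAdd (iterateFrobenius R p n.toAdd r)
    rw [iterateFrobenius_add_apply]
  smul_zero n := map_zero (iterateFrobenius R p n.toAdd)
  smul_add n := map_add (iterateFrobenius R p n.toAdd)
  smul_one n := map_one (iterateFrobenius R p n.toAdd)
  smul_mul n := map_mul (iterateFrobenius R p n.toAdd)

/-- The skew polynomial ring `R[x; f]`, where `f` is the Frobenius endomorphism of `R`; its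
multiplication is determined by `x * r = r ^ p * x`. -/
def FrobeniusSkewPolynomial (R : Type*) [CommRing R] (_p : ℕ) : Type _ := SkewPolynomial R

instance (R : Type*) [CommRing R] (p : ℕ) [Fact p.Prime] [CharP R p] :
    Ring (FrobeniusSkewPolynomial R p) :=
  letI := frobeniusAction R p
  inferInstanceAs (Ring (SkewPolynomial R))

/-- The monomial `r * x ^ n` of `R[x; f]`. -/
def FrobeniusSkewPolynomial.monomial (n : ℕ) (r : R) : FrobeniusSkewPolynomial R p :=
  SkewPolynomial.monomial n r

theorem FrobeniusSkewPolynomial.monomial_mul_monomial (m n : ℕ) (r s : R) :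
    monomial p m r * monomial p n s = monomial p (m + n) (r * s ^ p ^ m) := by
  let := frobeniusAction R p
  refine (SkewPolynomial.monomial_mul_monomial m n r s).trans ?_
  rw [SkewPolynomial.φ_iterate_apply]
  rfl

theorem FrobeniusSkewPolynomial.induction_on {P : FrobeniusSkewPolynomial R p → Prop}
    (c : FrobeniusSkewPolynomial R p) (h0 : P 0) (hm : ∀ n r, P (monomial p n r))
    (ha : ∀ f g, P f → P g → P (f + g)) : P c :=
  SkewMonoidAlgebra.induction_on (p := P) c h0 (fun n r => hm n.toAdd r) ha

/-- The map `M^{[q]}_N / L^{[q]}_N → M^{[pq]}_N / L^{[pq]}_N` sending the class of `m` to the class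
of `m ^ p`. -/
def bracketFrob (L M : Submodule R N) (e : ℕ) :
    BracketQuotient p L M e →ₛₗ[frobenius R p] BracketQuotient p L M (e + 1) :=
  Submodule.mapQ _ _
    ((FrobeniusPullback.frob p e).restrict (p := bracketPower p e M)
      (q := bracketPower p (e + 1) M) (frob_mem_bracketPower p e M))
    (fun z hz => frob_mem_bracketPower p e L z.1 hz)

/-- The graded `R`-module `⨁ₑ (M^{[pᵉ]}_N / L^{[pᵉ]}_N) Xᵉ`. -/
def BracketSum (L M : Submodule R N) : Type _ := ⨁ e : ℕ, BracketQuotient p L M e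

namespace BracketSum

variable (L M : Submodule R N)

instance : AddCommGroup (BracketSum p L M) :=
  inferInstanceAs (AddCommGroup (⨁ e : ℕ, BracketQuotient p L M e))

instance : Module R (BracketSum p L M) :=
  inferInstanceAs (Module R (⨁ e : ℕ, BracketQuotient p L M e))

/-- The homogeneous element `m Xᵉ`. -/
def of (e : ℕ) : BracketQuotient p L M e →ₗ[R] BracketSum p L M :=
  DirectSum.lof R ℕ (fun e => BracketQuotient p L M e) e

/-- The coefficient of `Xᵉ`. -/
def coeff (e : ℕ) : BracketSum p L M →ₗ[R] BracketQuotient p L M e :=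
  DirectSum.component R ℕ (fun e => BracketQuotient p L M e) e

theorem coeff_of_same (e : ℕ) (m : BracketQuotient p L M e) :
    coeff p L M e (of p L M e m) = m :=
  DirectSum.of_eq_same e m

theorem coeff_of_ne (e e' : ℕ) (h : e ≠ e') (m : BracketQuotient p L M e) :
    coeff p L M e' (of p L M e m) = 0 :=
  DirectSum.of_eq_of_ne e e' m h.symm

theorem sum_of_coeff (z : BracketSum p L M) :
    ∃ s : Finset ℕ, ∑ e ∈ s, of p L M e (coeff p L M e z) = z := by
  classical
  exact ⟨_, DirectSum.sum_support_of (β := fun e => BracketQuotient p L M e) z⟩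

/-- The additive endomorphism by which `x` acts: the class of `m` times `Xᵉ` is sent to the class
of `m ^ p` times `Xᵉ⁺¹`. -/
def xEnd : AddMonoid.End (BracketSum p L M) :=
  (DirectSum.toAddMonoid fun e =>
    (of p L M (e + 1)).toAddMonoidHom.comp (bracketFrob p L M e).toAddMonoidHom :
    (⨁ e : ℕ, BracketQuotient p L M e) →+ BracketSum p L M)

theorem xEnd_of (e : ℕ) (m : BracketQuotient p L M e) :
    xEnd p L M (of p L M e m) = of p L M (e + 1) (bracketFrob p L M e m) :=
  DirectSum.toAddMonoid_of _ e m

theorem induction_on {P : BracketSum p L M → Prop} (z : BracketSum p L M) (h0 : P 0)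
    (ho : ∀ e m, P (of p L M e m)) (ha : ∀ x y, P x → P y → P (x + y)) : P z :=
  DirectSum.induction_on (motive := P) z h0 ho ha

theorem xEnd_smul (a : R) (z : BracketSum p L M) :
    xEnd p L M (a • z) = a ^ p • xEnd p L M z := by
  induction z using induction_on with
  | h0 => simp
  | ho e m =>
    rw [← map_smul, xEnd_of, xEnd_of, ← map_smul, LinearMap.map_smulₛₗ]
    rfl
  | ha x y hx hy => rw [smul_add, map_add, hx, hy, map_add, smul_add]

theorem xEnd_pow_smul (n : ℕ) (a : R) (z : BracketSum p L M) :
    (xEnd p L M ^ n) (a • z) = a ^ p ^ n • (xEnd p L M ^ n) z := by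
  induction n with
  | zero => simp
  | succ n ih =>
    rw [pow_succ']
    change xEnd p L M ((xEnd p L M ^ n) (a • z)) = _ • xEnd p L M ((xEnd p L M ^ n) z)
    rw [ih, xEnd_smul, ← pow_mul, ← pow_succ]

/-- The ring homomorphism defining the `R[x; f]`-action. -/
def actionHom : FrobeniusSkewPolynomial R p →+* AddMonoid.End (BracketSum p L M) :=
  letI := frobeniusAction R p
  SkewMonoidAlgebra.liftNCRingHom (Module.toAddMonoidEnd R (BracketSum p L M))
    (powersHom _ (xEnd p L M)) (fun {r n} => AddMonoidHom.ext fun z =>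
      (xEnd_pow_smul p L M n.toAdd r z).symm)

/-- The left `R[x; f]`-module structure, in which `(r * x ^ n) • z = r • x ^ n • z` and
`x • (m Xᵉ) = m ^ p Xᵉ⁺¹`. -/
instance : Module (FrobeniusSkewPolynomial R p) (BracketSum p L M) :=
  Module.compHom _ (actionHom p L M)

theorem monomial_smul (n : ℕ) (r : R) (z : BracketSum p L M) :
    FrobeniusSkewPolynomial.monomial p n r • z = r • (xEnd p L M ^ n) z := by
  change actionHom p L M (SkewMonoidAlgebra.single (Multiplicative.ofAdd n) r) z = _
  let := frobeniusAction R p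
  erw [SkewMonoidAlgebra.liftNC_single]
  rfl

end BracketSum

theorem bracketFrob_mem_idealTorsion [IsNoetherianRing R] (I : Ideal R) (L M : Submodule R N)
    (e : ℕ) (m : BracketQuotient p L M e) (hm : m ∈ idealTorsion I (BracketQuotient p L M e)) :
    bracketFrob p L M e m ∈ idealTorsion I (BracketQuotient p L M (e + 1)) := by
  obtain ⟨n, hn⟩ := hm
  obtain ⟨k, hk⟩ : ∃ k : ℕ, I ^ k ≤ (I ^ n).map (frobenius R p) := by
    refine Ideal.exists_pow_le_of_le_radical_of_fg (fun r hr => ?_) (IsNoetherian.noetherian I)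
    refine ⟨n * p, ?_⟩
    rw [pow_mul]
    exact Ideal.mem_map_of_mem (frobenius R p) (Ideal.pow_mem_pow hr n)
  refine ⟨k, fun r hr => ?_⟩
  refine Submodule.span_induction
    (p := fun r _ => r • bracketFrob p L M e m = 0) ?_ ?_ ?_ ?_ (hk hr)
  · rintro _ ⟨s, hs, rfl⟩
    rw [← LinearMap.map_smulₛₗ, hn s hs, map_zero]
  · exact zero_smul _ _
  · intro a b _ _ ha hb
    rw [add_smul, ha, hb, add_zero]
  · intro a b _ hb
    rw [smul_eq_mul, mul_smul, hb, smul_zero]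

theorem coeff_xEnd_mem_idealTorsion [IsNoetherianRing R] (I : Ideal R) (L M : Submodule R N)
    (z : BracketSum p L M)
    (hz : ∀ e, BracketSum.coeff p L M e z ∈ idealTorsion I (BracketQuotient p L M e)) (e : ℕ) :
    BracketSum.coeff p L M e (BracketSum.xEnd p L M z) ∈
      idealTorsion I (BracketQuotient p L M e) := by
  obtain ⟨s, hs⟩ := BracketSum.sum_of_coeff p L M z
  rw [← hs, map_sum, map_sum]
  refine sum_mem fun i _ => ?_
  rw [BracketSum.xEnd_of]
  obtain rfl | h := eq_or_ne (i + 1) e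
  · rw [BracketSum.coeff_of_same]
    exact bracketFrob_mem_idealTorsion p I L M i _ (hz i)
  · rw [BracketSum.coeff_of_ne p L M _ _ h]
    exact zero_mem _

/-- The `R[x; f]`-submodule `ℋ = ⨁ₑ Γ_𝔪(M^{[pᵉ]}_N / L^{[pᵉ]}_N) Xᵉ` of
`⨁ₑ (M^{[pᵉ]}_N / L^{[pᵉ]}_N) Xᵉ`. -/
def torsionBracketSum [IsLocalRing R] [IsNoetherianRing R] (L M : Submodule R N) :
    Submodule (FrobeniusSkewPolynomial R p) (BracketSum p L M) where
  carrier := {z | ∀ e, BracketSum.coeff p L M e z ∈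
    idealTorsion (IsLocalRing.maximalIdeal R) (BracketQuotient p L M e)}
  zero_mem' e := by rw [map_zero]; exact zero_mem _
  add_mem' hx hy e := by rw [map_add]; exact add_mem (hx e) (hy e)
  smul_mem' c z hz e := by
    induction c using FrobeniusSkewPolynomial.induction_on with
    | h0 => rw [zero_smul, map_zero]; exact zero_mem _
    | hm n r =>
      rw [BracketSum.monomial_smul, map_smul]
      refine Submodule.smul_mem _ _ ?_
      induction n generalizing e with
      | zero => exact hz e
      | succ k ih =>
        rw [pow_succ']
        exact coeff_xEnd_mem_idealTorsion p _ L M _ ih e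
    | ha f g hf hg => rw [add_smul, map_add]; exact add_mem hf hg

end Main

end

/-! ### Lengths of quotients by ideals generated by powers -/

/-! Write $q=p^e$, $T_e=\Gamma_{\mathfrak m}(M^{[q]}_N/L^{[q]}_N)$ and $d=\dim R$. Two facts
combine.

Finite generation of $\mathcal H$ bounds the generators. Each of the finitely many generators of
$\mathcal H$ has finitely many components, and $x$ raises degree by one. So $T_e$ is spanned over
$R$ by boundedly many elements, the degree $e$ parts of $x^jz$ with $j\le e$. If $r^k z=0$, then
$r^{kp^j}x^jz=x^j(r^kz)=0$. Hence one $k$ makes $r^{kq}$ kill all these generators, for every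
$r\in\mathfrak m$ and every $e$ (`exists_generators_idealTorsion`).

Tight closure lowers the dimension by one. As $M/L$ is finitely generated, a single $c\in R^\circ$
kills $M^{[q]}_N/L^{[q]}_N$ for $q\gg0$ (`exists_ringCirc_smul_bracketQuotient_eq_zero`). If $c$ is
not a unit, it extends by at most $d-1$ elements $y_i\in\mathfrak m$ to an ideal of finite colength
(`exists_finset_length_quotient_ne_top`).

So for large $q$, $T_e$ is a quotient of a bounded number of copies of $R/(c,y_i^{kq})$. The length
of that ring is at most $(kq)^{d-1}\lambda(R/(c,y_i))$ when exactly $d-1$ elements occur, and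
$O(q^{d-1})$ in any case. The finitely many remaining $q$ are absorbed in the constant because every
$T_e$ has finite length. Division by $q^d$ leaves $O(1/q)$. -/

theorem Module.length_le_add_of_exact {R : Type*} [Ring R] {A B C : Type*} [AddCommGroup A]
    [AddCommGroup B] [AddCommGroup C] [Module R A] [Module R B] [Module R C]
    (f : A →ₗ[R] B) (g : B →ₗ[R] C) (hg : Function.Surjective g) (h : Function.Exact f g) :
    Module.length R B ≤ Module.length R A + Module.length R C := by
  rw [Module.length_eq_add_of_exact (LinearMap.range f).subtype g (Submodule.subtype_injective _) hg
    (by rw [LinearMap.exact_iff, Submodule.range_subtype, LinearMap.exact_iff.1 h])]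
  gcongr
  exact Module.length_le_of_surjective f.rangeRestrict f.surjective_rangeRestrict

section PowerIdeals

variable {R : Type*} [CommRing R]

theorem length_quotient_le_of_le {I J : Ideal R} (h : I ≤ J) :
    Module.length R (R ⧸ J) ≤ Module.length R (R ⧸ I) :=
  Module.length_le_of_surjective (Submodule.factor h) (Submodule.factor_surjective h)

/-- Multiplication by $a^m$ gives a right exact sequence $R/(I,a)\to R/(I,a^{m+1})\to
R/(I,a^m)\to0$. -/
theorem length_quotient_sup_span_pow_succ_le (I : Ideal R) (a : R) (m : ℕ) :
    Module.length R (R ⧸ (I ⊔ Ideal.span {a ^ (m + 1)})) ≤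
      Module.length R (R ⧸ (I ⊔ Ideal.span {a})) +
        Module.length R (R ⧸ (I ⊔ Ideal.span {a ^ m})) := by
  have h1 : I ⊔ Ideal.span {a} ≤
      Submodule.comap (LinearMap.mulLeft R (a ^ m)) (I ⊔ Ideal.span {a ^ (m + 1)}) := by
    refine sup_le (fun x hx => ?_) ?_
    · exact Ideal.mem_sup_left (I.mul_mem_left _ hx)
    · rw [Ideal.span, Submodule.span_le, Set.singleton_subset_iff]
      refine Ideal.mem_sup_right ?_
      rw [LinearMap.mulLeft_apply, ← pow_succ]
      exact Ideal.mem_span_singleton_self _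
  have h2 : I ⊔ Ideal.span {a ^ (m + 1)} ≤ I ⊔ Ideal.span {a ^ m} :=
    sup_le_sup_left (Ideal.span_singleton_le_span_singleton.2 (pow_dvd_pow a m.le_succ)) _
  refine Module.length_le_add_of_exact (Submodule.mapQ _ _ (LinearMap.mulLeft R (a ^ m)) h1)
    (Submodule.factor h2) (Submodule.factor_surjective h2) fun y => ?_
  obtain ⟨y, rfl⟩ := Submodule.Quotient.mk_surjective _ y
  have h3 : Submodule.factor h2 (Submodule.Quotient.mk y) = Submodule.Quotient.mk y := rfl
  rw [h3, Submodule.Quotient.mk_eq_zero]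
  constructor
  · intro hy
    obtain ⟨i, hi, j, hj, rfl⟩ := Submodule.mem_sup.1 hy
    obtain ⟨b, rfl⟩ := Ideal.mem_span_singleton'.1 hj
    refine ⟨Submodule.Quotient.mk b, ?_⟩
    rw [Submodule.mapQ_apply, Submodule.Quotient.eq, LinearMap.mulLeft_apply]
    refine Ideal.mem_sup_left ?_
    have : a ^ m * b - (i + b * a ^ m) = -i := by ring
    rw [this]
    exact neg_mem hi
  · rintro ⟨x, hx⟩
    obtain ⟨x, rfl⟩ := Submodule.Quotient.mk_surjective _ x
    rw [Submodule.mapQ_apply, Submodule.Quotient.eq, LinearMap.mulLeft_apply] at hx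
    have h4 : a ^ m * x ∈ I ⊔ Ideal.span {a ^ m} :=
      Ideal.mem_sup_right (Ideal.mul_mem_right _ _ (Ideal.mem_span_singleton_self _))
    simpa using sub_mem h4 (h2 hx)

theorem length_quotient_sup_span_pow_le (I : Ideal R) (a : R) (n : ℕ) :
    Module.length R (R ⧸ (I ⊔ Ideal.span {a ^ n})) ≤
      n * Module.length R (R ⧸ (I ⊔ Ideal.span {a})) := by
  induction n with
  | zero =>
    have : Subsingleton (R ⧸ (I ⊔ Ideal.span {a ^ 0})) := by
      rw [Ideal.Quotient.subsingleton_iff]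
      simp
    rw [Module.length_eq_zero]
    exact zero_le
  | succ m ih =>
    refine (length_quotient_sup_span_pow_succ_le I a m).trans ?_
    rw [Nat.cast_succ, add_mul, one_mul, add_comm]
    gcongr

theorem length_quotient_sup_finsetSup_span_pow_le (s : Finset R) (n : ℕ) (I : Ideal R) :
    Module.length R (R ⧸ (I ⊔ s.sup fun y => Ideal.span {y ^ n})) ≤
      (n : ℕ∞) ^ s.card * Module.length R (R ⧸ (I ⊔ s.sup fun y => Ideal.span {y})) := by
  classical
  induction s using Finset.induction_on generalizing I with
  | empty =>
    rw [Finset.card_empty, pow_zero, one_mul]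
    exact le_rfl
  | insert a s ha ih =>
    rw [Finset.sup_insert, Finset.sup_insert, ← sup_assoc, Finset.card_insert_of_notMem ha]
    -- The induction hypothesis is used for $I+(a^n)$, which is why `I` is generalized. The power
    -- $a^n$ is then traded for $a$ modulo $I$ and the elements of `s`.
    refine (ih _).trans ?_
    rw [pow_succ, mul_assoc, sup_right_comm, ← sup_assoc, sup_right_comm I (Ideal.span {a})]
    gcongr
    exact length_quotient_sup_span_pow_le _ a n

/-- `A` is a quotient of $(R/J)^n$. -/
theorem length_le_mul_length_quotient {A : Type*} [AddCommGroup A] [Module R A] {n : ℕ}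
    (g : Fin n → A) (hg : Submodule.span R (Set.range g) = ⊤) (J : Ideal R)
    (hJ : ∀ i, ∀ r ∈ J, r • g i = 0) :
    Module.length R A ≤ n * Module.length R (R ⧸ J) := by
  let φ (i : Fin n) : (R ⧸ J) →ₗ[R] A :=
    Submodule.liftQ J (LinearMap.toSpanSingleton R A (g i)) (fun r hr => hJ i r hr)
  have hφ (i : Fin n) (r : R) : φ i (Submodule.Quotient.mk r) = r • g i := rfl
  have hs : Function.Surjective (LinearMap.lsum R (fun _ : Fin n => R ⧸ J) R φ) := by
    rw [← LinearMap.range_eq_top, ← top_le_iff, ← hg, Submodule.span_le]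
    rintro _ ⟨i, rfl⟩
    refine ⟨Pi.single i (Submodule.Quotient.mk 1), ?_⟩
    rw [LinearMap.lsum_piSingle, hφ, one_smul]
  refine (Module.length_le_of_surjective _ hs).trans ?_
  simp

end PowerIdeals

/-! ### Parameters -/

section Parameters

/-- A chain of primes containing $c$ can be prolonged downwards by a minimal prime below its first
term. The step is strict because that minimal prime does not contain $c$. -/
theorem ringKrullDim_quotient_span_singleton_succ_le {R : Type*} [CommRing R] {c : R}
    (hc : c ∈ ringCirc R) : ringKrullDim (R ⧸ Ideal.span {c}) + 1 ≤ ringKrullDim R := by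
  by_cases hc' : Ideal.span {c} = ⊤
  · have : Subsingleton (R ⧸ Ideal.span {c}) := Ideal.Quotient.subsingleton_iff.2 hc'
    rw [ringKrullDim_eq_bot_of_subsingleton]
    simp
  have : Nonempty (PrimeSpectrum.zeroLocus (R := R) (Ideal.span {c})) := by
    rwa [Set.nonempty_coe_sort, Set.nonempty_iff_ne_empty, ne_eq,
      PrimeSpectrum.zeroLocus_empty_iff_eq_top]
  have := Ideal.Quotient.nontrivial_iff.mpr hc'
  have := (Ideal.Quotient.mk (Ideal.span {c})).domain_nontrivial
  rw [ringKrullDim_quotient, Order.krullDim_eq_iSup_length, ringKrullDim,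
    Order.krullDim_eq_iSup_length, ← WithBot.coe_one, ← WithBot.coe_add,
    ENat.iSup_add, WithBot.coe_le_coe, iSup_le_iff]
  intro l
  obtain ⟨P, hP, hP'⟩ := Ideal.exists_minimalPrimes_le (J := l.head.1.asIdeal) bot_le
  let P' : PrimeSpectrum R := ⟨P, hP.1.1⟩
  have hP' : P' < l.head := lt_of_le_of_ne hP' fun h ↦ hc P hP <| by
    have h1 : c ∈ l.head.1.asIdeal := l.head.2 (Ideal.mem_span_singleton_self c)
    rw [← h] at h1
    exact h1
  refine le_trans ?_ (le_iSup _ ((l.map Subtype.val (fun _ _ ↦ id)).cons P' hP'))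
  have hlen : ((l.map Subtype.val (fun _ _ ↦ id)).cons P' hP').length = l.length + 1 := by
    change 0 + l.length + 1 = l.length + 1
    rw [zero_add]
  rw [hlen, Nat.cast_succ]

variable {R : Type*} [CommRing R] [IsLocalRing R] [IsNoetherianRing R]

theorem length_quotient_ne_top_of_maximalIdeal_mem_minimalPrimes {J : Ideal R}
    (hJ : IsLocalRing.maximalIdeal R ∈ J.minimalPrimes) : Module.length R (R ⧸ J) ≠ ⊤ := by
  have := IsLocalRing.quotient_artinian_of_mem_minimalPrimes_of_isLocalRing J hJ
  have : IsArtinian R (R ⧸ J) :=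
    isArtinian_of_surjective_algebraMap (Ideal.Quotient.mk_surjective (I := J))
  exact Module.length_ne_top

/-- An element outside all minimal primes is part of a system of parameters. -/
theorem exists_finset_length_quotient_ne_top {c : R} (hc : c ∈ ringCirc R) (hu : ¬ IsUnit c) :
    ∃ s : Finset R, s.card + 1 ≤ krullDimNat R ∧ (∀ y ∈ s, y ∈ IsLocalRing.maximalIdeal R) ∧
      Module.length R (R ⧸ (Ideal.span {c} ⊔ s.sup fun y => Ideal.span {y})) ≠ ⊤ := by
  classical
  set π := Ideal.Quotient.mk (Ideal.span {c}) with hπ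
  have hsurj : Function.Surjective π := Ideal.Quotient.mk_surjective
  have : Nontrivial (R ⧸ Ideal.span {c}) := Ideal.Quotient.nontrivial_iff.2
    (by rwa [ne_eq, Ideal.span_singleton_eq_top])
  have := IsLocalRing.of_surjective' π hsurj
  have := IsLocalHom.of_surjective π hsurj
  -- A system of parameters of $R/(c)$: as many elements as the height of the maximal ideal, which
  -- is minimal over them. The section `g` lifts them to $R$.
  obtain ⟨s, hs, hcard⟩ :=
    (IsLocalRing.maximalIdeal (R ⧸ Ideal.span {c})).exists_finset_card_eq_height_of_isNoetherianRing
  obtain ⟨g, hg⟩ := hsurj.hasRightInverse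
  have hcomap : (IsLocalRing.maximalIdeal (R ⧸ Ideal.span {c})).comap π =
      IsLocalRing.maximalIdeal R := (IsLocalRing.local_hom_TFAE π).out 0 4 |>.1 ‹IsLocalHom π›
  have hspan : (Ideal.span (s : Set (R ⧸ Ideal.span {c}))).comap π =
      Ideal.span {c} ⊔ (s.image g).sup fun y => Ideal.span {y} := by
    have h1 : Ideal.span (s : Set (R ⧸ Ideal.span {c})) =
        ((s.image g).sup fun y => Ideal.span {y}).map π := by
      have h2 : ((s.image g).sup fun y => Ideal.span {y}) = Ideal.span (g '' s) := by
        rw [Finset.sup_image, Finset.sup_eq_iSup]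
        refine Eq.trans ?_ (Submodule.span_eq_iSup_of_singleton_spans (R := R) (g '' s)).symm
        rw [iSup_image]
        rfl
      rw [h2, Ideal.map_span, ← Set.image_comp]
      rw [Function.RightInverse.comp_eq_id hg, Set.image_id]
    rw [h1, Ideal.comap_map_of_surjective π hsurj, sup_comm, ← RingHom.ker_eq_comap_bot, hπ,
      Ideal.mk_ker]
  refine ⟨s.image g, ?_, ?_, ?_⟩
  · have h1 := ringKrullDim_quotient_span_singleton_succ_le hc
    rw [← IsLocalRing.maximalIdeal_height_eq_ringKrullDim, ← hcard, ← coe_krullDimNat] at h1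
    have h2 : s.card + 1 ≤ krullDimNat R := by exact_mod_cast h1
    have := Finset.card_image_le (s := s) (f := g)
    omega
  · intro y hy
    obtain ⟨z, hz, rfl⟩ := Finset.mem_image.1 hy
    rw [← hcomap, Ideal.mem_comap, hg z]
    exact hs.1.2 (Ideal.subset_span hz)
  -- Minimality of the maximal ideal over $(s)$ in $R/(c)$ pulls back to minimality of $\mathfrak m$
  -- over the preimage of $(s)$.
  · rw [← hspan]
    refine length_quotient_ne_top_of_maximalIdeal_mem_minimalPrimes ?_
    rw [← hcomap]
    exact Ideal.minimalPrimes_comap_of_surjective hsurj hs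

end Parameters

/-! ### ### A uniform multiplier from tight closure -/

section TightClosure

variable {R : Type*} [CommRing R] (p : ℕ) [Fact p.Prime] [CharP R p]
variable {N : Type*} [AddCommGroup N] [Module R N]

/-- The elements `z` of `N` with `c • z ^ q ∈ L^{[q]}_N`, `q = p ^ e`. -/
def bracketColon (L : Submodule R N) (c : R) (e : ℕ) : Submodule R N where
  carrier := {z | c • FrobeniusPullback.pow p e z ∈ bracketPower p e L}
  zero_mem' := by
    have h : FrobeniusPullback.pow p e (0 : N) = (0 : FrobeniusPullback R p e N) :=
      FrobeniusPullback.tmul_zero (1 : R)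
    rw [Set.mem_ofPred_eq, h, smul_zero]
    exact zero_mem _
  add_mem' := by
    intro x y hx hy
    rw [Set.mem_ofPred_eq, FrobeniusPullback.pow, FrobeniusPullback.tmul_add, smul_add]
    exact add_mem hx hy
  smul_mem' := by
    intro a x hx
    have : c • FrobeniusPullback.pow (R := R) p e (a • x) =
        a ^ p ^ e • c • FrobeniusPullback.pow (R := R) p e x := by
      simp only [FrobeniusPullback.pow, FrobeniusPullback.tmul_smul,
        FrobeniusPullback.smul_tmul]
      congr 1
      ring
    rw [Set.mem_ofPred_eq, this]
    exact Submodule.smul_mem _ _ hx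

theorem mem_bracketColon {L : Submodule R N} {c : R} {e : ℕ} {z : N} :
    z ∈ bracketColon p L c e ↔ c • FrobeniusPullback.pow p e z ∈ bracketPower p e L := Iff.rfl

theorem pow_mem_bracketPower (e : ℕ) {L : Submodule R N} {z : N} (hz : z ∈ L) :
    FrobeniusPullback.pow p e z ∈ bracketPower p e L :=
  ⟨FrobeniusPullback.pow p e (⟨z, hz⟩ : L), rfl⟩

/-- $M^{[q]}_N$ is spanned over $R$ by the powers $m^q$ with $m\in M$, so it suffices to multiply
these by $c$. -/
theorem smul_mem_bracketPower_of_le_bracketColon {L M : Submodule R N} {c : R} {e : ℕ}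
    (h : M ≤ bracketColon p L c e) {u : FrobeniusPullback R p e N}
    (hu : u ∈ bracketPower p e M) : c • u ∈ bracketPower p e L := by
  obtain ⟨w, rfl⟩ := hu
  induction w using FrobeniusPullback.induction_on with
  | h0 => simp
  | ht r n =>
    have h1 : FrobeniusPullback.map p e M.subtype (FrobeniusPullback.tmul p e r n) =
        r • FrobeniusPullback.pow p e (n : N) := by
      rw [FrobeniusPullback.map_tmul, FrobeniusPullback.pow, FrobeniusPullback.smul_tmul, mul_one]
      rfl
    rw [h1, smul_comm]
    exact Submodule.smul_mem _ _ (h n.2)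
  | ha x y hx hy =>
    rw [map_add, smul_add]
    exact add_mem hx hy

/-- The product of the multipliers of the individual elements serves for all of them. -/
theorem exists_ringCirc_forall_mem_bracketColon {L : Submodule R N} (T : Finset N)
    (hT : ∀ z ∈ T, z ∈ tightClosure p L) :
    ∃ c ∈ ringCirc R, ∀ᶠ e : ℕ in atTop, ∀ z ∈ T, z ∈ bracketColon p L c e := by
  classical
  induction T using Finset.induction_on with
  | empty => exact ⟨1, one_mem _, by simp⟩
  | insert a T _ ih =>
    obtain ⟨c, hc, h⟩ := ih fun z hz => hT z (Finset.mem_insert_of_mem hz)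
    obtain ⟨c', hc', h'⟩ := hT a (Finset.mem_insert_self a T)
    refine ⟨c * c', mul_mem hc hc', ?_⟩
    filter_upwards [h, h'] with e h h' z hz
    rw [mem_bracketColon]
    obtain rfl | hz := Finset.mem_insert.1 hz
    · rw [mul_smul]
      exact Submodule.smul_mem _ _ h'
    · rw [mul_comm, mul_smul]
      exact Submodule.smul_mem _ _ (h z hz)

/-- If `M / L` is finitely generated and `M ⊆ L^*_N`, then a single `c ∈ R°` multiplies
`M^{[q]}_N` into `L^{[q]}_N` for all large `q`. -/
theorem exists_ringCirc_smul_bracketQuotient_eq_zero {L M : Submodule R N}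
    (hfin : Module.Finite R (↥M ⧸ L.submoduleOf M)) (hM : M ≤ tightClosure p L) :
    ∃ c ∈ ringCirc R, ∀ᶠ e : ℕ in atTop, ∀ z : BracketQuotient p L M e, c • z = 0 := by
  classical
  obtain ⟨S, hS⟩ := hfin.fg_top
  obtain ⟨g, hg⟩ := (Submodule.mkQ_surjective (L.submoduleOf M)).hasRightInverse
  obtain ⟨c, hc, h⟩ := exists_ringCirc_forall_mem_bracketColon p (S.image fun s => (g s : N))
    (L := L) (by
      intro z hz
      obtain ⟨s, _, rfl⟩ := Finset.mem_image.1 hz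
      exact hM (g s).2)
  refine ⟨c, hc, ?_⟩
  filter_upwards [h] with e he z
  have hle : M ≤ bracketColon p L c e := by
    intro m hm
    -- `bracketColon p L c e` is a submodule that contains $L$ and lifts of generators of $M/L$,
    -- hence all of $M$. The induction runs over classes in $M/L$, for every representative at once.
    have h1 : ∀ q : ↥M ⧸ L.submoduleOf M, ∀ m : M, (L.submoduleOf M).mkQ m = q →
        (m : N) ∈ bracketColon p L c e := by
      have hL : ∀ x ∈ L, x ∈ bracketColon p L c e := fun x hx =>
        Submodule.smul_mem _ _ (pow_mem_bracketPower p e hx)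
      have hrep : ∀ m m' : M, (L.submoduleOf M).mkQ m = (L.submoduleOf M).mkQ m' →
          (m' : N) ∈ bracketColon p L c e → (m : N) ∈ bracketColon p L c e := by
        intro m m' hmm hm'
        have h2 : m - m' ∈ L.submoduleOf M := (Submodule.Quotient.eq _).1 hmm
        have h3 := add_mem (hL _ h2) hm'
        simpa using h3
      intro q
      have hq : q ∈ Submodule.span R (S : Set (↥M ⧸ L.submoduleOf M)) := hS ▸ Submodule.mem_top
      induction hq using Submodule.span_induction with
      | mem x hx =>
        intro m hm
        exact hrep m (g x) (hm.trans (hg x).symm) (he _ (Finset.mem_image_of_mem _ hx))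
      | zero =>
        intro m hm
        exact hrep m 0 (by rw [hm, map_zero]) (zero_mem _)
      | add x y _ _ hx hy =>
        intro m hm
        exact hrep m (g x + g y) (by rw [hm, map_add, hg x, hg y])
          (add_mem (hx _ (hg x)) (hy _ (hg y)))
      | smul a x _ hx =>
        intro m hm
        exact hrep m (a • g x) (by rw [hm, map_smul, hg x])
          (Submodule.smul_mem _ a (hx _ (hg x)))
    exact h1 _ ⟨m, hm⟩ rfl
  obtain ⟨u, rfl⟩ := Submodule.Quotient.mk_surjective _ z
  rw [← Submodule.Quotient.mk_smul, Submodule.Quotient.mk_eq_zero]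
  exact smul_mem_bracketPower_of_le_bracketColon p hle u.2

end TightClosure

/-! ### Generators of the torsion in each degree -/

section Generators

variable {R : Type*} [CommRing R] (p : ℕ) [Fact p.Prime] [CharP R p]
variable {N : Type*} [AddCommGroup N] [Module R N] (L M : Submodule R N)

theorem exists_xEnd_pow_of (n e : ℕ) (m : BracketQuotient p L M e) :
    ∃ m' : BracketQuotient p L M (e + n),
      (BracketSum.xEnd p L M ^ n) (BracketSum.of p L M e m) = BracketSum.of p L M (e + n) m' := by
  induction n with
  | zero => exact ⟨m, rfl⟩
  | succ n ih =>
    obtain ⟨m', hm'⟩ := ih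
    refine ⟨bracketFrob p L M (e + n) m', ?_⟩
    rw [pow_succ']
    change BracketSum.xEnd p L M ((BracketSum.xEnd p L M ^ n) _) = _
    rw [hm', BracketSum.xEnd_of]
    rfl

theorem coeff_xEnd_pow_eq_zero (n e : ℕ) (z : BracketSum p L M)
    (hz : ∀ i, i + n = e → BracketSum.coeff p L M i z = 0) :
    BracketSum.coeff p L M e ((BracketSum.xEnd p L M ^ n) z) = 0 := by
  obtain ⟨s, hs⟩ := BracketSum.sum_of_coeff p L M z
  rw [← hs, map_sum, map_sum]
  refine Finset.sum_eq_zero fun i _ => ?_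
  by_cases h : i + n = e
  · rw [hz i h, map_zero, map_zero, map_zero]
  · obtain ⟨m', hm'⟩ := exists_xEnd_pow_of p L M n i (BracketSum.coeff p L M i z)
    rw [hm', BracketSum.coeff_of_ne p L M _ _ h]

theorem exists_bound_coeff (z : BracketSum p L M) :
    ∃ B : ℕ, ∀ i, B ≤ i → BracketSum.coeff p L M i z = 0 := by
  obtain ⟨s, hs⟩ := BracketSum.sum_of_coeff p L M z
  refine ⟨s.sup id + 1, fun i hi => ?_⟩
  rw [← hs, map_sum]
  refine Finset.sum_eq_zero fun j hj => BracketSum.coeff_of_ne p L M _ _ ?_ _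
  rintro rfl
  have := Finset.le_sup (f := id) hj
  simp only [id] at this
  omega

variable [IsLocalRing R] [IsNoetherianRing R]

/-- One exponent suffices because an element of the direct sum has finitely many nonzero components.
-/
theorem exists_pow_smul_eq_zero_of_mem_torsionBracketSum {z : BracketSum p L M}
    (hz : z ∈ torsionBracketSum p L M) :
    ∃ k : ℕ, ∀ r ∈ IsLocalRing.maximalIdeal R, r ^ k • z = 0 := by
  obtain ⟨s, hs⟩ := BracketSum.sum_of_coeff p L M z
  choose n hn using fun e => hz e
  refine ⟨s.sup n, fun r hr => ?_⟩
  rw [← hs, Finset.smul_sum]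
  refine Finset.sum_eq_zero fun e he => ?_
  rw [← map_smul, hn e _ (Ideal.pow_le_pow_right (Finset.le_sup he) (Ideal.pow_mem_pow hr _)),
    map_zero]

theorem xEnd_pow_mem_torsionBracketSum (n : ℕ) {z : BracketSum p L M}
    (hz : z ∈ torsionBracketSum p L M) :
    (BracketSum.xEnd p L M ^ n) z ∈ torsionBracketSum p L M := by
  have h := (torsionBracketSum p L M).smul_mem (FrobeniusSkewPolynomial.monomial p n (1 : R)) hz
  rwa [BracketSum.monomial_smul, one_smul] at h

/-- If `ℋ` is finitely generated over `R[x; f]`, its graded pieces are generated by a bounded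
number of elements, all killed by the `k * p ^ e`-th powers of the elements of `𝔪`. -/
theorem exists_generators_idealTorsion
    (hH : Module.Finite (FrobeniusSkewPolynomial R p) ↥(torsionBracketSum p L M)) :
    ∃ n k : ℕ, ∀ e : ℕ, ∃ g : Fin n →
      idealTorsion (IsLocalRing.maximalIdeal R) (BracketQuotient p L M e),
      Submodule.span R (Set.range g) = ⊤ ∧
        ∀ i, ∀ r ∈ IsLocalRing.maximalIdeal R, r ^ (k * p ^ e) • g i = 0 := by
  classical
  have hp : 0 < p := (Fact.out : p.Prime).pos
  obtain ⟨S, hS⟩ := (Module.Finite.iff_fg.1 hH)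
  have hmem : ∀ z ∈ S, z ∈ torsionBracketSum p L M := fun z hz => hS ▸ Submodule.subset_span hz
  choose! B hB using fun z : BracketSum p L M => exists_bound_coeff p L M z
  choose! k hk using fun (z : BracketSum p L M) (hz : z ∈ torsionBracketSum p L M) =>
    exists_pow_smul_eq_zero_of_mem_torsionBracketSum p L M hz
  set b := S.sup B
  set K := S.sup k
  -- The generator indexed by $(z,i)$ is $x^{e-i}$ applied to the degree $i$ component of $z$. The
  -- test $i\le e$ guards against truncated subtraction, and `b` exceeds every degree in which some
  -- $z\in S$ is nonzero.
  let G (e : ℕ) (x : S × Fin b) : idealTorsion (IsLocalRing.maximalIdeal R)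
      (BracketQuotient p L M e) :=
    ⟨if (x.2 : ℕ) ≤ e then
      BracketSum.coeff p L M e ((BracketSum.xEnd p L M ^ (e - x.2)) x.1) else 0, by
      split_ifs
      · exact xEnd_pow_mem_torsionBracketSum p L M _ (hmem _ x.1.2) e
      · exact zero_mem _⟩
  refine ⟨Fintype.card (S × Fin b), K, fun e =>
    ⟨G e ∘ (Fintype.equivFin (S × Fin b)).symm, ?_, ?_⟩⟩
  · rw [EquivLike.range_comp]
    -- Quantifying over all powers of $x$ makes the induction close: $x^n(rx^mz)=r^{p^n}x^{n+m}z$.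
    have key : ∀ z ∈ torsionBracketSum p L M, ∀ n,
        BracketSum.coeff p L M e ((BracketSum.xEnd p L M ^ n) z) ∈
          (Submodule.span R (Set.range (G e))).map (Submodule.subtype _) := by
      intro z hz
      rw [← hS] at hz
      induction hz using Submodule.span_induction with
      | mem z hz =>
        intro n
        by_cases h : n ≤ e ∧ e - n < b
        · refine ⟨G e (⟨z, hz⟩, ⟨e - n, h.2⟩), Submodule.subset_span ⟨_, rfl⟩, ?_⟩
          simp only [G, Submodule.subtype_apply]
          rw [if_pos (Nat.sub_le _ _), Nat.sub_sub_self h.1]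
        · rw [coeff_xEnd_pow_eq_zero]
          · exact zero_mem _
          · intro i hi
            refine hB z i ((Finset.le_sup hz : B z ≤ b).trans ?_)
            omega
      | zero => simp
      | add x y _ _ hx hy =>
        intro n
        rw [map_add, map_add]
        exact add_mem (hx n) (hy n)
      | smul a x _ hx =>
        induction a using FrobeniusSkewPolynomial.induction_on with
        | h0 => simp
        | hm m r =>
          intro n
          rw [BracketSum.monomial_smul, BracketSum.xEnd_pow_smul, map_smul]
          refine Submodule.smul_mem _ _ ?_
          have h := hx (n + m)
          rwa [pow_add] at h
        | ha f g hf hg =>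
          intro n
          rw [add_smul, map_add, map_add]
          exact add_mem (hf n) (hg n)
    rw [← top_le_iff]
    intro u _
    have hu : BracketSum.of p L M e u ∈ torsionBracketSum p L M := by
      intro i
      obtain rfl | h := eq_or_ne e i
      · rw [BracketSum.coeff_of_same]
        exact u.2
      · rw [BracketSum.coeff_of_ne p L M _ _ h]
        exact zero_mem _
    have h := key _ hu 0
    rw [pow_zero, AddMonoid.End.coe_one, id, BracketSum.coeff_of_same] at h
    obtain ⟨v, hv, hvu⟩ := h
    rwa [← Subtype.ext hvu]
  · rintro i r hr
    set x := (Fintype.equivFin (S × Fin b)).symm i with hx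
    rw [Subtype.ext_iff]
    change r ^ (K * p ^ e) • ((G e x : _) : BracketQuotient p L M e) = 0
    simp only [G]
    split_ifs with h
    · have h1 : r ^ K • (x.1 : BracketSum p L M) = 0 := by
        have h2 : k x.1 ≤ K := Finset.le_sup x.1.2
        rw [← Nat.sub_add_cancel h2, pow_add, mul_smul, hk _ (hmem _ x.1.2) r hr, smul_zero]
      -- Frobenius semilinearity: $r^{Kp^j}x^jz=x^j(r^Kz)=0$ with $j=e-i$. The exponent is then
      -- enlarged to $Kp^e$, uniformly in $i$.
      have h3 : r ^ (K * p ^ (e - x.2)) • (BracketSum.xEnd p L M ^ (e - x.2)) x.1 = 0 := by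
        rw [pow_mul, ← BracketSum.xEnd_pow_smul, h1, map_zero]
      have h4 : K * p ^ (e - x.2) ≤ K * p ^ e :=
        Nat.mul_le_mul_left _ (Nat.pow_le_pow_right hp (Nat.sub_le _ _))
      rw [← map_smul, ← Nat.sub_add_cancel h4, pow_add, mul_smul, h3, smul_zero, map_zero]
    · rw [smul_zero]

end Generators

/-! ### ### Length bounds for the torsion -/

section TorsionLength

variable {R : Type*} [CommRing R] [IsLocalRing R]
variable (p : ℕ) [Fact p.Prime] [CharP R p]
variable {N : Type*} [AddCommGroup N] [Module R N] {L M : Submodule R N}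

/-- The ideal $(c,\,y^{kq}: y\in s)$ kills every generator. The choice $c=0$ gives finiteness for
all $e$; a multiplier $c\in R^\circ$ gives the sharp growth for large $e$. -/
theorem length_idealTorsion_le {e n k : ℕ}
    {g : Fin n → idealTorsion (IsLocalRing.maximalIdeal R) (BracketQuotient p L M e)}
    (hg : Submodule.span R (Set.range g) = ⊤)
    (hk : ∀ i, ∀ r ∈ IsLocalRing.maximalIdeal R, r ^ (k * p ^ e) • g i = 0)
    {c : R} (hc : ∀ z : BracketQuotient p L M e, c • z = 0) {s : Finset R}
    (hs : ∀ y ∈ s, y ∈ IsLocalRing.maximalIdeal R) :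
    Module.length R (idealTorsion (IsLocalRing.maximalIdeal R) (BracketQuotient p L M e)) ≤
      n * (((k * p ^ e : ℕ) : ℕ∞) ^ s.card *
        Module.length R (R ⧸ (Ideal.span {c} ⊔ s.sup fun y => Ideal.span {y}))) := by
  refine (length_le_mul_length_quotient g hg
    (Ideal.span {c} ⊔ s.sup fun y => Ideal.span {y ^ (k * p ^ e)}) fun i r hr => ?_).trans ?_
  · have hle : Ideal.span {c} ⊔ (s.sup fun y => Ideal.span {y ^ (k * p ^ e)}) ≤
        LinearMap.ker (LinearMap.toSpanSingleton R _ (g i)) := by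
      refine sup_le ?_ (Finset.sup_le fun y hy => ?_)
      · rw [Ideal.span_singleton_le_iff_mem]
        exact Subtype.ext (hc _)
      · rw [Ideal.span_singleton_le_iff_mem]
        exact hk i y (hs y hy)
    exact hle hr
  · gcongr
    exact length_quotient_sup_finsetSup_span_pow_le s _ _

variable [IsNoetherianRing R]

theorem torsionLength_ne_top
    (hH : Module.Finite (FrobeniusSkewPolynomial R p) ↥(torsionBracketSum p L M)) (e : ℕ) :
    torsionLength p L M e ≠ ∞ := by
  obtain ⟨n, k, h⟩ := exists_generators_idealTorsion p L M hH
  obtain ⟨g, hg, hk⟩ := h e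
  -- With $c=0$ and $s$ generating $\mathfrak m$, the residual length is at most that of
  -- $R/\mathfrak m$.
  obtain ⟨s, hs⟩ := IsNoetherian.noetherian (IsLocalRing.maximalIdeal R)
  have hsup : IsLocalRing.maximalIdeal R ≤
      Ideal.span {(0 : R)} ⊔ s.sup fun y => Ideal.span {y} := by
    rw [← hs, Submodule.span_le]
    intro y hy
    exact Ideal.mem_sup_right (Finset.le_sup (f := fun y => Ideal.span {y}) hy
      (Ideal.mem_span_singleton_self y))
  have hlen : Module.length R
      (R ⧸ (Ideal.span {(0 : R)} ⊔ s.sup fun y => Ideal.span {y})) ≠ ⊤ := by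
    refine ne_top_of_le_ne_top ?_ (length_quotient_le_of_le hsup)
    refine length_quotient_ne_top_of_maximalIdeal_mem_minimalPrimes ?_
    rw [Ideal.minimalPrimes_eq_subsingleton_self]
    rfl
  have h1 := length_idealTorsion_le p hg hk (c := 0) (fun z => zero_smul _ z) (s := s)
    fun y hy => hs ▸ Submodule.subset_span hy
  rw [torsionLength, ne_eq, ENat.toENNReal_eq_top]
  refine ne_top_of_le_ne_top ?_ h1
  exact WithTop.mul_ne_top (ENat.natCast_ne_top _)
    (WithTop.mul_ne_top (by exact_mod_cast ENat.natCast_ne_top ((k * p ^ e) ^ s.card)) hlen)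

theorem exists_eventually_torsionLength_le
    (hfin : Module.Finite R (↥M ⧸ L.submoduleOf M))
    (hH : Module.Finite (FrobeniusSkewPolynomial R p) ↥(torsionBracketSum p L M))
    (hM : M ≤ tightClosure p L) :
    ∃ C : ℝ≥0, ∀ᶠ e : ℕ in atTop,
      torsionLength p L M e ≤ (C : ℝ≥0∞) * ((p : ℝ≥0∞) ^ e) ^ ((krullDimNat R : ℤ) - 1) := by
  obtain ⟨c, hc, hce⟩ := exists_ringCirc_smul_bracketQuotient_eq_zero p hfin hM
  -- A unit $c$ makes the modules vanish for large $e$. If $d=0$ this is the only case, since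
  -- $\mathfrak m$ is then a minimal prime; otherwise the negative exponent $d-1$ would matter.
  by_cases hu : IsUnit c
  · refine ⟨0, ?_⟩
    filter_upwards [hce] with e he
    have : Subsingleton (BracketQuotient p L M e) :=
      subsingleton_of_forall_eq 0 fun z => (hu.smul_eq_zero).1 (he z)
    rw [torsionLength, Module.length_eq_zero]
    simp
  obtain ⟨s, hcard, hs, hlen⟩ := exists_finset_length_quotient_ne_top hc hu
  obtain ⟨n, k, h⟩ := exists_generators_idealTorsion p L M hH
  obtain ⟨l, hl⟩ := ENat.ne_top_iff_exists.1 hlen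
  -- Here $n$ counts the generators, $k^{|s|}$ comes from the exponents $kq$, and
  -- $l=\lambda(R/(c,s))$.
  refine ⟨(n * (k ^ s.card * l) : ℕ), ?_⟩
  filter_upwards [hce] with e he
  obtain ⟨g, hg, hk⟩ := h e
  have h1 := length_idealTorsion_le p hg hk he hs
  rw [← hl] at h1
  have h2 : torsionLength p L M e ≤ ((n * ((k * p ^ e) ^ s.card * l) : ℕ) : ℝ≥0∞) := by
    rw [torsionLength, ← ENat.toENNReal_coe, ENat.toENNReal_le]
    exact_mod_cast h1
  refine h2.trans ?_
  -- `hcard` forces $d\ge1$, so truncated and integer subtraction agree.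
  have h3 : (krullDimNat R : ℤ) - 1 = ((krullDimNat R - 1 : ℕ) : ℤ) := by omega
  have h4 : (p ^ e) ^ s.card ≤ (p ^ e) ^ (krullDimNat R - 1) :=
    Nat.pow_le_pow_right (pow_pos (Fact.out : p.Prime).pos e) (by omega)
  rw [h3, zpow_natCast]
  calc ((n * ((k * p ^ e) ^ s.card * l) : ℕ) : ℝ≥0∞)
      = ((n * (k ^ s.card * l) * (p ^ e) ^ s.card : ℕ) : ℝ≥0∞) := by
        congr 1
        ring
    _ ≤ ((n * (k ^ s.card * l) * (p ^ e) ^ (krullDimNat R - 1) : ℕ) : ℝ≥0∞) := by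
        exact_mod_cast Nat.mul_le_mul_left _ h4
    _ = _ := by push_cast; rfl

end TorsionLength

/-- The finitely many early ratios $f(e)/w(e)$ are finite, so their sum can be added to the
constant. -/
theorem exists_forall_le_of_eventually_le {f w : ℕ → ℝ≥0∞} (hf : ∀ e, f e ≠ ∞)
    (hw : ∀ e, w e ≠ 0) (hwt : ∀ e, w e ≠ ∞)
    (h : ∃ C : ℝ≥0, ∀ᶠ e in atTop, f e ≤ C * w e) :
    ∃ C : ℝ≥0, ∀ e, f e ≤ C * w e := by
  obtain ⟨C, hC⟩ := h
  obtain ⟨n, hn⟩ := eventually_atTop.1 hC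
  refine ⟨C + ∑ i ∈ Finset.range n, (f i / w i).toNNReal, fun e => ?_⟩
  obtain he | he := le_or_gt n e
  · refine (hn e he).trans ?_
    gcongr
    exact le_self_add
  · have h1 : (f e / w e).toNNReal ≤ C + ∑ i ∈ Finset.range n, (f i / w i).toNNReal :=
      (Finset.single_le_sum (f := fun i => (f i / w i).toNNReal) (fun _ _ => zero_le)
        (Finset.mem_range.2 he)).trans le_add_self
    have h2 : f e / w e ≠ ∞ := ENNReal.div_ne_top (hf e) (hw e)
    calc f e = f e / w e * w e := (ENNReal.div_mul_cancel (hw e) (hwt e)).symm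
      _ = (f e / w e).toNNReal * w e := by rw [ENNReal.coe_toNNReal h2]
      _ ≤ _ := by gcongr

theorem mainTheorem8 {R : Type*} [CommRing R] [IsLocalRing R] [IsNoetherianRing R]
    (p : ℕ) [Fact p.Prime] [CharP R p]
    {N : Type*} [AddCommGroup N] [Module R N]
    (L M : Submodule R N) (hLM : L ≤ M)
    (hfin : Module.Finite R (↥M ⧸ L.submoduleOf M))
    (hH : Module.Finite (FrobeniusSkewPolynomial R p) ↥(torsionBracketSum p L M))
    (hM : M ≤ tightClosure p L) :
    HasRelMult p L M 0 ∧
      ∃ C : ℝ≥0, ∀ e : ℕ,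
        torsionLength p L M e ≤ (C : ℝ≥0∞) * ((p : ℝ≥0∞) ^ e) ^ ((krullDimNat R : ℤ) - 1) := by
  have hp0 : (p : ℝ≥0∞) ≠ 0 := Nat.cast_ne_zero.2 (Fact.out : p.Prime).ne_zero
  have hpt : (p : ℝ≥0∞) ≠ ∞ := ENNReal.natCast_ne_top p
  have hq0 (e : ℕ) : (p : ℝ≥0∞) ^ e ≠ 0 := pow_ne_zero _ hp0
  have hqt (e : ℕ) : (p : ℝ≥0∞) ^ e ≠ ∞ := ENNReal.pow_ne_top hpt
  obtain ⟨C, hC⟩ := exists_forall_le_of_eventually_le (torsionLength_ne_top p hH)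
    (fun e => (ENNReal.zpow_pos (hq0 e) (hqt e) ((krullDimNat R : ℤ) - 1)).ne')
    (fun e => (ENNReal.zpow_lt_top (hq0 e) (hqt e) _).ne)
    (exists_eventually_torsionLength_le p hfin hH hM)
  have hbound (e : ℕ) : torsionLength p L M e / ((p : ℝ≥0∞) ^ e) ^ krullDimNat R ≤
      C * (p : ℝ≥0∞)⁻¹ ^ e := by
    -- $q^{d-1}=q^{-1}q^d$, with $q^{-1}=(p^{-1})^e$.
    refine ENNReal.div_le_of_le_mul ((hC e).trans_eq ?_)
    rw [sub_eq_neg_add, ENNReal.zpow_add (hq0 e) (hqt e), zpow_natCast, zpow_neg_one,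
      ← ENNReal.inv_pow, mul_assoc]
  have hlim : Tendsto (fun e : ℕ => torsionLength p L M e / ((p : ℝ≥0∞) ^ e) ^ krullDimNat R)
      atTop (nhds 0) := by
    have h1 : Tendsto (fun e : ℕ => (C : ℝ≥0∞) * (p : ℝ≥0∞)⁻¹ ^ e) atTop (nhds (C * 0)) := by
      refine ENNReal.Tendsto.const_mul (ENNReal.tendsto_pow_atTop_nhds_zero_of_lt_one ?_)
        (Or.inr ENNReal.coe_ne_top)
      rw [ENNReal.inv_lt_one]
      exact_mod_cast (Fact.out : p.Prime).one_lt
    rw [mul_zero] at h1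
    exact tendsto_of_tendsto_of_tendsto_of_le_of_le tendsto_const_nhds h1 (fun _ => zero_le) hbound
  exact ⟨⟨hlim.limsup_eq, hlim.liminf_eq⟩, C, hC⟩
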